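/- Let $k\ge 2$, let $p_1,\dots,p_k\in\mathbb{R}^3$ be distinct collinear points, let $m\ge 0$, and let $$\phi(x)=m+\sum_{i=1}^k\frac{1}{2|x-p_i|}.$$ Let $X$ be the hyperkähler 4-manifold given by the Gibbons–Hawking ansatz with harmonic function $\phi$ (multi-Eguchi–Hanson, ALE, if $m=0$; multi-Taub–NUT, ALF, if $m>0$). That is, $X$ is a smooth 4-manifold with a smooth action of $U(1)$ (with $2\pi$-periodic infinitesimal generator $\xi$), a smooth surjective map $\mu:X\to\mathbb{R}^3$ whose fibres are the orbits, such that the action is free over $Y=\mathbb{R}^3\setminus\{p_1,\dots,p_k\}$ and each $\mu^{-1}(p_i)$ is a single fixed point, and a smooth Riemannian metric $g$ which on $\mu^{-1}(Y)$ is $$g=\phi^{-1}\eta^2+\phi\,(d\mu_1^2+d\mu_2^2+d\mu_3^2),$$ where $\eta$ is a smooth 1-form on $\mu^{-1}(Y)$ with $\eta(\xi)=1$ and $d\eta=-{*d\phi}$ (pulled back by $\mu$; $*$ is the Euclidean Hodge star). A *geodesic orbit* is a $U(1)$-orbit in $X$, other than a fixed point, which is a geodesic of $g$. Call $p_i$ and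 $p_j$ ($i\ne j$) *adjacent* if no $p_l$ lies strictly between them. Then $X$ has exactly $k-1$ geodesic orbits. Each of them projects under $\mu$ to a point of the open segment between two adjacent points, and for every pair of adjacent points there is exactly one geodesic orbit that projects into the open segment between them. -/

import Mathlib

open scoped Manifold ContDiff

namespace GibbonsHawking

/-- Euclidean 3-space, the target of the moment map. -/
abbrev E3 : Type := EuclideanSpace ℝ (Fin 3)

/-- Euclidean 4-space, the model of the 4-manifolds considered here. -/
abbrev E4 : Type := EuclideanSpace ℝ (Fin 4)

noncomputable section

/-- The cross product of Euclidean 3-space, for its standard orientation. -/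
def cross (v w : E3) : E3 := WithLp.toLp 2 (crossProduct (WithLp.ofLp v) (WithLp.ofLp w))

/-- The Euclidean Hodge star of a 1-form on Euclidean 3-space, evaluated on two vectors:
`(⋆ α) (v, w) = α (v × w)`, so that `⋆ dx₁ = dx₂ ∧ dx₃` and cyclically. -/
def hodgeStar (α : E3 →L[ℝ] ℝ) (v w : E3) : ℝ := α (cross v w)

/-- The harmonic function `m + ∑ i, 1 / (2 |x - p i|)`. For `m = 0` it defines the multi-Eguchi-Hanson
(ALE) metrics and for `m > 0` the multi-Taub-NUT (ALF) metrics. Its value at a point `p i` is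
irrelevant. -/
def potential {k : ℕ} (m : ℝ) (p : Fin k → E3) (x : E3) : ℝ :=
  m + ∑ i, 1 / (2 * ‖x - p i‖)

section Manifold

variable {X : Type*} [TopologicalSpace X] [ChartedSpace E4 X]

/-- The velocity at time `t` of a curve `γ` in a 4-manifold. -/
def velocity (γ : ℝ → X) (t : ℝ) : TangentSpace (𝓡 4) (γ t) :=
  mfderiv 𝓘(ℝ, ℝ) (𝓡 4) γ t (1 : ℝ)

/-- The differential at `x` of a map `μ = (μ₁, μ₂, μ₃)` to Euclidean 3-space. -/
def differential (μ : X → E3) (x : X) (v : TangentSpace (𝓡 4) x) : E3 :=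
  mfderiv (𝓡 4) 𝓘(ℝ, E3) μ x v

/-- The orbit curve `t ↦ exp (i t) • x` of a circle action. Its velocity is the infinitesimal
generator `ξ` of the action. -/
def orbitCurve [MulAction Circle X] (x : X) (t : ℝ) : X := Circle.exp t • x

variable [IsManifold (𝓡 4) ∞ X]

variable (X) in
/-- Smooth Riemannian metrics on a smooth 4-manifold. -/
abbrev Metric : Type _ :=
  Bundle.ContMDiffRiemannianMetric (𝓡 4) ∞ E4 (fun x : X => TangentSpace (𝓡 4) x)

/-- The energy of the curve `γ` on the interval `[a, b]`. -/
def energy (g : Metric X) (γ : ℝ → X) (a b : ℝ) : ℝ :=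
  ∫ t in a..b, g.inner (γ t) (velocity γ t) (velocity γ t) / 2

/-- A geodesic of `g`: a smooth curve which is, on every compact interval, a critical point of the
energy for all smooth variations `F s` of `γ = F 0` with fixed end points. -/
def IsGeodesic (g : Metric X) (γ : ℝ → X) : Prop :=
  ContMDiff 𝓘(ℝ, ℝ) (𝓡 4) ∞ γ ∧
  ∀ a b : ℝ, a < b → ∀ F : ℝ → ℝ → X,
    ContMDiff 𝓘(ℝ, ℝ × ℝ) (𝓡 4) ∞ (fun q : ℝ × ℝ => F q.1 q.2) →
    (∀ t, F 0 t = γ t) → (∀ s, F s a = γ a) → (∀ s, F s b = γ b) →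
    HasDerivAt (fun s => energy g (F s) a b) 0 0

/-- `IsExteriorDerivOn U η Ω` says that `dη = Ω` on `U`, for a 1-form `η` and a bilinear form `Ω`
(a 2-form): for every locally defined smooth map `F` from the `(s, t)`-plane to `U`, one has
`d (F^* η) = F^* Ω`, that is `∂ₛ (η (∂ₜ F)) - ∂ₜ (η (∂ₛ F)) = Ω (∂ₛ F, ∂ₜ F)`. Taking for `F` the
coordinate planes of charts gives the coordinate expression of `dη = Ω`. -/
def IsExteriorDerivOn (U : Set X) (η : ∀ x : X, TangentSpace (𝓡 4) x →L[ℝ] ℝ)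
    (Ω : ∀ x : X, TangentSpace (𝓡 4) x → TangentSpace (𝓡 4) x → ℝ) : Prop :=
  ∀ (F : ℝ → ℝ → X) (s t : ℝ), F s t ∈ U →
    ContMDiffAt 𝓘(ℝ, ℝ × ℝ) (𝓡 4) ∞ (fun q : ℝ × ℝ => F q.1 q.2) (s, t) →
    deriv (fun s' => η (F s' t) (velocity (fun t' => F s' t') t)) s
      - deriv (fun t' => η (F s t') (velocity (fun s' => F s' t') s)) t
      = Ω (F s t) (velocity (fun s' => F s' t) s) (velocity (fun t' => F s t') t)

variable (X) in
/-- The structure given on a smooth 4-manifold `X` by the Gibbons-Hawking ansatz with harmonic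
function `φ`, whose singular set is `S`: a smooth circle action, a Riemannian metric `g`, the moment
map `μ`, which away from `S` is a principal circle bundle with connection 1-form `η` and collapses
the circles over `S`, such that `(η, φ)` is a Dirac monopole and `g = φ⁻¹ η² + φ ∑ dμᵢ²`. Such a
metric is hyperkähler, with Kähler forms `η ∧ dμᵢ + φ dμⱼ ∧ dμₖ`. -/
structure GibbonsHawkingSpace [MulAction Circle X] (S : Set E3) (φ : E3 → ℝ) where
  /-- The metric. It is smooth on all of `X`, also at the fixed points of the action. -/
  g : Metric X
  /-- The moment map, or projection. -/
  μ : X → E3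
  /-- The connection 1-form; only its values over the complement of `S` matter. -/
  η : ∀ x : X, TangentSpace (𝓡 4) x →L[ℝ] ℝ
  smooth_smul : ContMDiffSMul (𝓡 1) (𝓡 4) ∞ Circle X
  smooth_μ : ContMDiff (𝓡 4) 𝓘(ℝ, E3) ∞ μ
  surjective_μ : Function.Surjective μ
  /-- The fibres of `μ` are the orbits of the circle action. -/
  fibre_eq_orbit : ∀ x y : X, μ y = μ x ↔ y ∈ MulAction.orbit Circle x
  /-- The action is free over the complement of `S`. -/
  free : ∀ x : X, μ x ∉ S → ∀ c : Circle, c • x = x → c = 1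
  /-- The circles collapse to points over `S`. -/
  fixed : ∀ x : X, μ x ∈ S → ∀ c : Circle, c • x = x
  smooth_η : ContMDiffOn (𝓡 4) ((𝓡 4).prod 𝓘(ℝ, E4 →L[ℝ] ℝ)) ∞
    (fun x => Bundle.TotalSpace.mk' (E4 →L[ℝ] ℝ)
      (E := fun x : X => TangentSpace (𝓡 4) x →L[ℝ] Bundle.Trivial X ℝ x) x (η x))
    (μ ⁻¹' Sᶜ)
  /-- `η (ξ) = 1`. -/
  η_generator : ∀ x : X, μ x ∉ S → ∀ t : ℝ,
    η (orbitCurve x t) (velocity (orbitCurve x) t) = 1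
  /-- The Bogomolny (monopole) equation `dη = - ⋆ dφ`, where the right-hand side is pulled back to
  `X` by `μ`. -/
  monopole : IsExteriorDerivOn (μ ⁻¹' Sᶜ) η fun x v w =>
    - hodgeStar (fderiv ℝ φ (μ x)) (differential μ x v) (differential μ x w)
  /-- The metric is `g = φ⁻¹ η² + φ (dμ₁² + dμ₂² + dμ₃²)`. -/
  metric_eq : ∀ x : X, μ x ∉ S → ∀ v w : TangentSpace (𝓡 4) x,
    g.inner x v w = (φ (μ x))⁻¹ * (η x v * η x w)
      + φ (μ x) * inner ℝ (differential μ x v) (differential μ x w)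

/-- The set `O` is a geodesic orbit: an orbit of the circle action, not reduced to a fixed point,
which is a geodesic of the metric. -/
def IsGeodesicOrbit [MulAction Circle X] (g : Metric X) (O : Set X) : Prop :=
  ∃ x : X, x ∉ MulAction.fixedPoints Circle X ∧ O = MulAction.orbit Circle x ∧
    IsGeodesic g (orbitCurve x)

end Manifold

/-- For collinear points: `p i` and `p j` are adjacent if they are distinct and no other point of the
family lies between them. -/
def Adjacent {k : ℕ} (p : Fin k → E3) (i j : Fin k) : Prop :=
  p i ≠ p j ∧ ∀ l, p l ∉ openSegment ℝ (p i) (p j)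

end

end GibbonsHawking

/-! Geodesic orbits correspond to critical points of `φ` away from the `p i`, and those are counted
on the line.

Over the complement of `S` the energy density of a curve `γ` is `(φ⁻¹ η(γ')² + φ |(μ ∘ γ)'|²) / 2`.
Along an orbit `η(γ') = 1` and `(μ ∘ γ)' = 0`, so under a variation `F` the second term, being
quadratic, contributes nothing to first order. The first contributes `-(2 φ²)⁻¹ dφ(∂ₛ μ) + φ⁻¹ ∂ₛ
(η(∂ₜ F))`. As `dη` is pulled back by `μ` and `∂ₜ F` is vertical at `s = 0`, the monopole equation
gives `∂ₛ (η(∂ₜ F)) = ∂ₜ (η(∂ₛ F))`, which integrates to zero when the end points are fixed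
(`hasDerivAt_energy`). Since `μ` is a submersion there, the orbit is a geodesic exactly when `dφ =
0` below it (`isGeodesic_orbitCurve_iff`).

If `∇φ` vanishes at `q`, then `q` is a barycentre of the `p i` with positive weights, hence on their
line (`critical_iff_of_line`). There the condition is equilibrium among equal charges. The force
strictly decreases between consecutive charges, is positive near the left one and negative near the
right one, and has constant sign outside all charges: each gap holds exactly one zero
(`existsUnique_lineForce_eq_zero`, `encard_lineForce_eq_zero`). -/

namespace GibbonsHawking

open Bundle

/-! ### Smoothness of two-parameter families and differentiation of integrals. -/

section Families

variable {X : Type*} [TopologicalSpace X] [ChartedSpace E4 X]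

/-- The velocity in the second variable of a smooth two-parameter family, as a total derivative. -/
lemma velocity_snd_eq {F : ℝ → ℝ → X}
    (hF : ContMDiff 𝓘(ℝ, ℝ × ℝ) (𝓡 4) ∞ (fun q : ℝ × ℝ => F q.1 q.2)) (s t : ℝ) :
    velocity (F s) t
      = mfderiv 𝓘(ℝ, ℝ × ℝ) (𝓡 4) (fun q : ℝ × ℝ => F q.1 q.2) (s, t) ((0, 1) : ℝ × ℝ) := by
  have h2 : HasMFDerivAt 𝓘(ℝ, ℝ) 𝓘(ℝ, ℝ × ℝ) (fun t' : ℝ => (s, t')) t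
      (ContinuousLinearMap.inr ℝ ℝ ℝ) :=
    (hasFDerivAt_prodMk_right s t).hasMFDerivAt
  have h1 := ((hF (s, t)).mdifferentiableAt (by simp)).hasMFDerivAt
  have h3 := (HasMFDerivAt.comp t h1 h2).mfderiv
  change mfderiv 𝓘(ℝ, ℝ) (𝓡 4) (F s) t = _ at h3
  unfold velocity
  rw [h3]
  rfl

/-- The velocity in the first variable of a smooth two-parameter family, as a total derivative. -/
lemma velocity_fst_eq {F : ℝ → ℝ → X}
    (hF : ContMDiff 𝓘(ℝ, ℝ × ℝ) (𝓡 4) ∞ (fun q : ℝ × ℝ => F q.1 q.2)) (s t : ℝ) :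
    velocity (fun s' => F s' t) s
      = mfderiv 𝓘(ℝ, ℝ × ℝ) (𝓡 4) (fun q : ℝ × ℝ => F q.1 q.2) (s, t) ((1, 0) : ℝ × ℝ) := by
  have h2 : HasMFDerivAt 𝓘(ℝ, ℝ) 𝓘(ℝ, ℝ × ℝ) (fun s' : ℝ => (s', t)) s
      (ContinuousLinearMap.inl ℝ ℝ ℝ) :=
    (hasFDerivAt_prodMk_left s t).hasMFDerivAt
  have h1 := ((hF (s, t)).mdifferentiableAt (by simp)).hasMFDerivAt
  have h3 := (HasMFDerivAt.comp s h1 h2).mfderiv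
  change mfderiv 𝓘(ℝ, ℝ) (𝓡 4) (fun s' => F s' t) s = _ at h3
  unfold velocity
  rw [h3]
  rfl

/-- Chain rule for the differential of a map to Euclidean space along a curve. -/
lemma differential_velocity {μ : X → E3} (hμ : ContMDiff (𝓡 4) 𝓘(ℝ, E3) ∞ μ) {γ : ℝ → X}
    (hγ : ContMDiff 𝓘(ℝ, ℝ) (𝓡 4) ∞ γ) (t : ℝ) :
    differential μ (γ t) (velocity γ t) = deriv (fun t' => μ (γ t')) t := by
  have h1 := ((hμ (γ t)).mdifferentiableAt (by simp)).hasMFDerivAt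
  have h2 := ((hγ t).mdifferentiableAt (by simp)).hasMFDerivAt
  have h3 := (HasMFDerivAt.comp t h1 h2).mfderiv
  rw [mfderiv_eq_fderiv] at h3
  change _ = fderiv ℝ (μ ∘ γ) t 1
  rw [h3]
  rfl

/-- A curve obtained by freezing the first variable of a smooth family is smooth. -/
lemma contMDiff_snd_of_family {F : ℝ → ℝ → X}
    (hF : ContMDiff 𝓘(ℝ, ℝ × ℝ) (𝓡 4) ∞ (fun q : ℝ × ℝ => F q.1 q.2)) (s : ℝ) :
    ContMDiff 𝓘(ℝ, ℝ) (𝓡 4) ∞ (F s) :=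
  hF.comp (contDiff_prodMk_right s).contMDiff

/-- A curve obtained by freezing the second variable of a smooth family is smooth. -/
lemma contMDiff_fst_of_family {F : ℝ → ℝ → X}
    (hF : ContMDiff 𝓘(ℝ, ℝ × ℝ) (𝓡 4) ∞ (fun q : ℝ × ℝ => F q.1 q.2)) (t : ℝ) :
    ContMDiff 𝓘(ℝ, ℝ) (𝓡 4) ∞ (fun s => F s t) :=
  hF.comp (contDiff_prodMk_left t).contMDiff

variable [IsManifold (𝓡 4) ∞ X]

/-- The derivative of a smooth map of the plane in a fixed direction is a smooth vector field
along it. -/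
lemma contMDiff_mfderiv_const {F : ℝ × ℝ → X} (hF : ContMDiff 𝓘(ℝ, ℝ × ℝ) (𝓡 4) ∞ F)
    (e : ℝ × ℝ) :
    ContMDiff 𝓘(ℝ, ℝ × ℝ) ((𝓡 4).prod 𝓘(ℝ, E4)) ∞
      (fun q => TotalSpace.mk' E4 (E := fun x : X => TangentSpace (𝓡 4) x) (F q)
        (mfderiv 𝓘(ℝ, ℝ × ℝ) (𝓡 4) F q e)) := by
  -- The field is the tangent map of `F` composed with the constant section `e`.
  have hsec : ContMDiff 𝓘(ℝ, ℝ × ℝ) 𝓘(ℝ, ℝ × ℝ).tangent ∞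
      (fun q : ℝ × ℝ => (⟨q, e⟩ : TangentBundle 𝓘(ℝ, ℝ × ℝ) (ℝ × ℝ))) :=
    contMDiff_vectorSpace_iff_contDiff.2 contDiff_const
  exact (hF.contMDiff_tangentMap (m := ∞) (by simp)).comp hsec

lemma contMDiff_velocity_snd {F : ℝ → ℝ → X}
    (hF : ContMDiff 𝓘(ℝ, ℝ × ℝ) (𝓡 4) ∞ (fun q : ℝ × ℝ => F q.1 q.2)) :
    ContMDiff 𝓘(ℝ, ℝ × ℝ) ((𝓡 4).prod 𝓘(ℝ, E4)) ∞
      (fun q : ℝ × ℝ => TotalSpace.mk' E4 (E := fun x : X => TangentSpace (𝓡 4) x) (F q.1 q.2)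
        (velocity (F q.1) q.2)) := by
  simp_rw [velocity_snd_eq hF]
  exact contMDiff_mfderiv_const hF (0, 1)

lemma contMDiff_velocity_fst {F : ℝ → ℝ → X}
    (hF : ContMDiff 𝓘(ℝ, ℝ × ℝ) (𝓡 4) ∞ (fun q : ℝ × ℝ => F q.1 q.2)) :
    ContMDiff 𝓘(ℝ, ℝ × ℝ) ((𝓡 4).prod 𝓘(ℝ, E4)) ∞
      (fun q : ℝ × ℝ => TotalSpace.mk' E4 (E := fun x : X => TangentSpace (𝓡 4) x) (F q.1 q.2)
        (velocity (fun s => F s q.2) q.1)) := by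
  simp_rw [velocity_fst_eq hF]
  exact contMDiff_mfderiv_const hF (1, 0)

/-- The energy density of a smooth two-parameter family is smooth. -/
lemma contDiff_energyDensity (g : Metric X) {F : ℝ → ℝ → X}
    (hF : ContMDiff 𝓘(ℝ, ℝ × ℝ) (𝓡 4) ∞ (fun q : ℝ × ℝ => F q.1 q.2)) :
    ContDiff ℝ ∞ (fun q : ℝ × ℝ =>
      g.inner (F q.1 q.2) (velocity (F q.1) q.2) (velocity (F q.1) q.2) / 2) := by
  have hv := contMDiff_velocity_snd hF
  have : ContMDiff 𝓘(ℝ, ℝ × ℝ) ((𝓡 4).prod 𝓘(ℝ)) ∞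
      (fun q : ℝ × ℝ => TotalSpace.mk' ℝ (E := Bundle.Trivial X ℝ) (F q.1 q.2)
        (g.inner (F q.1 q.2) (velocity (F q.1) q.2) (velocity (F q.1) q.2))) :=
    ContMDiff.clm_bundle_apply₂ (F₁ := E4) (F₂ := E4)
      (E₁ := fun x : X => TangentSpace (𝓡 4) x) (E₂ := fun x : X => TangentSpace (𝓡 4) x)
      (g.contMDiff.comp hF) hv hv
  have h2 : ContDiff ℝ ∞ (fun q : ℝ × ℝ =>
      g.inner (F q.1 q.2) (velocity (F q.1) q.2) (velocity (F q.1) q.2)) := by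
    rw [← contMDiff_iff_contDiff]
    intro q
    have := this q
    simp only [contMDiffAt_totalSpace] at this
    exact this.2
  exact h2.div_const 2

/-- A smooth 1-form applied to a smooth vector field along a map is smooth. -/
lemma contDiffAt_form_apply {U : Set X} (hU : IsOpen U)
    {η : ∀ x : X, TangentSpace (𝓡 4) x →L[ℝ] ℝ}
    (hη : ContMDiffOn (𝓡 4) ((𝓡 4).prod 𝓘(ℝ, E4 →L[ℝ] ℝ)) ∞
      (fun x => TotalSpace.mk' (E4 →L[ℝ] ℝ)
        (E := fun x : X => TangentSpace (𝓡 4) x →L[ℝ] Bundle.Trivial X ℝ x) x (η x)) U)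
    {F : ℝ × ℝ → X} {v : ∀ q, TangentSpace (𝓡 4) (F q)}
    (hv : ContMDiff 𝓘(ℝ, ℝ × ℝ) ((𝓡 4).prod 𝓘(ℝ, E4)) ∞
      (fun q => TotalSpace.mk' E4 (E := fun x : X => TangentSpace (𝓡 4) x) (F q) (v q)))
    {q : ℝ × ℝ} (hq : F q ∈ U) :
    ContDiffAt ℝ ∞ (fun q => η (F q) (v q)) q := by
  have hF : ContMDiffAt 𝓘(ℝ, ℝ × ℝ) (𝓡 4) ∞ F q := (contMDiffAt_totalSpace.1 (hv q)).1
  have h1 := ((hη (F q) hq).contMDiffAt (hU.mem_nhds hq)).comp q hF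
  have : ContMDiffAt 𝓘(ℝ, ℝ × ℝ) ((𝓡 4).prod 𝓘(ℝ)) ∞
      (fun q => TotalSpace.mk' ℝ (E := Bundle.Trivial X ℝ) (F q) (η (F q) (v q))) q :=
    ContMDiffAt.clm_bundle_apply (F₁ := E4) (F₂ := ℝ)
      (E₁ := fun x : X => TangentSpace (𝓡 4) x) (E₂ := Bundle.Trivial X ℝ)
      (ϕ := fun q => η (F q)) (v := v) (b := F) h1 (hv q)
  rw [← contMDiffAt_iff_contDiffAt]
  simp only [contMDiffAt_totalSpace] at this
  exact this.2

end Families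

/-- Differentiation under the integral sign for a smooth function of two variables. -/
lemma hasDerivAt_integral_of_contDiff {f : ℝ × ℝ → ℝ} (hf : ContDiff ℝ 1 f) (a b s₀ : ℝ) :
    HasDerivAt (fun s => ∫ t in a..b, f (s, t)) (∫ t in a..b, deriv (fun s => f (s, t)) s₀) s₀ := by
  have hd : ∀ s t, HasDerivAt (fun s => f (s, t)) (fderiv ℝ f (s, t) (1, 0)) s := fun s t =>
    ((hf.differentiable one_ne_zero (s, t)).hasFDerivAt.comp_hasDerivAt s
      ((hasDerivAt_id s).prodMk (hasDerivAt_const s t)))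
  have hc : Continuous fun q : ℝ × ℝ => fderiv ℝ f q (1, 0) :=
    (hf.continuous_fderiv one_ne_zero).clm_apply continuous_const
  -- Compactness bounds the `s`-derivative uniformly for `s` near `s₀`; this constant is the
  -- dominating function.
  obtain ⟨C, hC⟩ := ((isCompact_closedBall s₀ 1).prod (isCompact_uIcc (a := a) (b := b))
    ).exists_bound_of_continuousOn hc.continuousOn
  have := (intervalIntegral.hasDerivAt_integral_of_dominated_loc_of_deriv_le
    (μ := MeasureTheory.volume) (a := a) (b := b)
    (F := fun s t => f (s, t)) (F' := fun s t => fderiv ℝ f (s, t) (1, 0)) (x₀ := s₀)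
    (bound := fun _ => C) (Metric.closedBall_mem_nhds s₀ one_pos)
    (.of_forall fun s => (hf.continuous.comp (by fun_prop)).aestronglyMeasurable)
    ((hf.continuous.comp (by fun_prop)).intervalIntegrable _ _)
    (hc.comp (by fun_prop : Continuous fun t => (s₀, t))).aestronglyMeasurable
    (.of_forall fun t ht s hs => hC (s, t) ⟨hs, Set.uIoc_subset_uIcc ht⟩)
    intervalIntegrable_const
    (.of_forall fun t _ s _ => hd s t)).2
  simpa only [(hd _ _).deriv] using this

end GibbonsHawking

namespace GibbonsHawking

open Bundle Topology

/-! ### First variation of the energy of an orbit. -/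

section FirstVariation

variable {X : Type*} [TopologicalSpace X] [ChartedSpace E4 X] [IsManifold (𝓡 4) ∞ X]
  [MulAction Circle X] {S : Set E3} {φ : E3 → ℝ}

omit [IsManifold (𝓡 4) ∞ X] [MulAction Circle X] in
lemma velocity_eq_zero_of_const {γ : ℝ → X} {x : X} (h : ∀ t, γ t = x) (t : ℝ) :
    velocity γ t = 0 := by
  obtain rfl : γ = fun _ => x := funext h
  unfold velocity
  rw [mfderiv_const]
  rfl

lemma GibbonsHawkingSpace.μ_smul (G : GibbonsHawkingSpace X S φ) (c : Circle) (x : X) :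
    G.μ (c • x) = G.μ x :=
  (G.fibre_eq_orbit x (c • x)).2 ⟨c, rfl⟩

/-- The derivative of the energy density of a variation of an orbit, in the variation parameter. -/
lemma GibbonsHawkingSpace.hasDerivAt_energyDensity (G : GibbonsHawkingSpace X S φ)
    (hS : IsClosed S) {x : X} (hx : G.μ x ∉ S) (hφ : DifferentiableAt ℝ φ (G.μ x))
    (hφ0 : φ (G.μ x) ≠ 0) {F : ℝ → ℝ → X}
    (hF : ContMDiff 𝓘(ℝ, ℝ × ℝ) (𝓡 4) ∞ (fun q : ℝ × ℝ => F q.1 q.2))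
    (hF0 : ∀ t, F 0 t = orbitCurve x t) (t : ℝ) :
    HasDerivAt (fun s => G.g.inner (F s t) (velocity (F s) t) (velocity (F s) t) / 2)
      (-(2 * φ (G.μ x) ^ 2)⁻¹ * fderiv ℝ φ (G.μ x) (deriv (fun s => G.μ (F s t)) 0)
        + (φ (G.μ x))⁻¹ * deriv (fun t' => G.η (F 0 t') (velocity (fun s => F s t') 0)) t) 0 := by
  have hU : IsOpen (G.μ ⁻¹' Sᶜ) := hS.isOpen_compl.preimage G.smooth_μ.continuous
  have hμ0 : ∀ t, G.μ (F 0 t) = G.μ x := fun t => by rw [hF0]; exact G.μ_smul _ _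
  have hmem : F 0 t ∈ G.μ ⁻¹' Sᶜ := by
    change G.μ (F 0 t) ∉ S
    rwa [hμ0]
  have hu : ContDiff ℝ ∞ (fun q : ℝ × ℝ => G.μ (F q.1 q.2)) :=
    contMDiff_iff_contDiff.1 (G.smooth_μ.comp hF)
  have hus : HasDerivAt (fun s => G.μ (F s t)) (deriv (fun s => G.μ (F s t)) 0) 0 :=
    ((hu.comp (contDiff_prodMk_left t)).differentiable (by simp) 0).hasDerivAt
  have hφu : HasDerivAt (fun s => φ (G.μ (F s t)))
      (fderiv ℝ φ (G.μ x) (deriv (fun s => G.μ (F s t)) 0)) 0 := by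
    have h := hφ.hasFDerivAt
    rw [← hμ0 t] at h
    have h2 := h.comp_hasDerivAt (0 : ℝ) hus
    rw [hμ0 t] at h2
    exact h2
  set w : ℝ → E3 := fun s => deriv (fun t' => G.μ (F s t')) t with hw
  have hw0 : w 0 = 0 := by simp [hw, hμ0]
  have hwd : DifferentiableAt ℝ w 0 := by
    have : w = fun s => fderiv ℝ (fun q : ℝ × ℝ => G.μ (F q.1 q.2)) (s, t) (0, 1) := by
      funext s
      exact ((hu.differentiable (by simp) (s, t)).hasFDerivAt.comp_hasDerivAt t
        ((hasDerivAt_const t s).prodMk (hasDerivAt_id t))).deriv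
    rw [this]
    have h1 : ContDiff ℝ ∞ (fderiv ℝ (fun q : ℝ × ℝ => G.μ (F q.1 q.2))) :=
      (contDiff_infty_iff_fderiv.1 hu).2
    exact ((h1.comp (contDiff_prodMk_left t)).clm_apply contDiff_const).differentiable
      (by simp) 0
  -- The horizontal velocity vanishes at `s = 0`, so its square has zero derivative there.
  have hwi : HasDerivAt (fun s => inner ℝ (w s) (w s)) 0 0 := by
    simpa [hw0] using hwd.hasDerivAt.inner ℝ hwd.hasDerivAt
  set h : ℝ → ℝ := fun s => G.η (F s t) (velocity (F s) t) with hh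
  have hh0 : h 0 = 1 := by
    have hF0' : F 0 = orbitCurve x := funext hF0
    simp only [hh]
    rw [hF0']
    exact G.η_generator x hx t
  have hhd : HasDerivAt h
      (deriv (fun t' => G.η (F 0 t') (velocity (fun s => F s t') 0)) t) 0 := by
    have hsm : DifferentiableAt ℝ h 0 :=
      ((contDiffAt_form_apply hU G.smooth_η (contMDiff_velocity_snd hF) (q := (0, t)) hmem).comp
        (0 : ℝ) (contDiff_prodMk_left t).contDiffAt).differentiableAt (by simp)
    -- The orbit is vertical, so the curvature term drops out and the two mixed derivatives of `η`
    -- agree.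
    have hmon := G.monopole F 0 t hmem (hF _)
    have hz : differential G.μ (F 0 t) (velocity (F 0) t) = 0 := by
      rw [differential_velocity G.smooth_μ (contMDiff_snd_of_family hF 0)]
      exact hw0
    have hcr : ∀ v : E3, cross v 0 = 0 := fun v => by simp [cross]
    change _ = - hodgeStar _ _ (differential G.μ (F 0 t) (velocity (F 0) t)) at hmon
    rw [hz, hodgeStar, hcr, map_zero, neg_zero, sub_eq_zero] at hmon
    rw [← hmon]
    exact hsm.hasDerivAt
  have hmain := (((hφu.inv (by rwa [hμ0])).mul (hhd.mul hhd)).add (hφu.mul hwi)).div_const 2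
  -- The formula for `g` holds only over the complement of `S`, which is open: this suffices for
  -- small `s`.
  have hev : (fun s => G.g.inner (F s t) (velocity (F s) t) (velocity (F s) t) / 2) =ᶠ[𝓝 0]
      fun s => ((φ (G.μ (F s t)))⁻¹ * (h s * h s) + φ (G.μ (F s t)) * inner ℝ (w s) (w s)) / 2 := by
    have hc : Continuous fun s => F s t := (contMDiff_fst_of_family hF t).continuous
    filter_upwards [hc.continuousAt.preimage_mem_nhds (hU.mem_nhds hmem)] with s hs
    rw [G.metric_eq (F s t) hs,
      differential_velocity G.smooth_μ (contMDiff_snd_of_family hF s)]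
  refine (hmain.congr_of_eventuallyEq hev).congr_deriv ?_
  simp only [Pi.mul_apply, Pi.inv_apply, hh0, hw0, hμ0, inner_zero_left]
  field_simp
  ring

/-- The first variation of the energy of an orbit. -/
lemma GibbonsHawkingSpace.hasDerivAt_energy (G : GibbonsHawkingSpace X S φ)
    (hS : IsClosed S) {x : X} (hx : G.μ x ∉ S) (hφ : DifferentiableAt ℝ φ (G.μ x))
    (hφ0 : φ (G.μ x) ≠ 0) {F : ℝ → ℝ → X}
    (hF : ContMDiff 𝓘(ℝ, ℝ × ℝ) (𝓡 4) ∞ (fun q : ℝ × ℝ => F q.1 q.2))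
    (hF0 : ∀ t, F 0 t = orbitCurve x t) {a b : ℝ}
    (ha : ∀ s, F s a = orbitCurve x a) (hb : ∀ s, F s b = orbitCurve x b) :
    HasDerivAt (fun s => energy G.g (F s) a b)
      (-(2 * φ (G.μ x) ^ 2)⁻¹ *
        ∫ t in a..b, fderiv ℝ φ (G.μ x) (deriv (fun s => G.μ (F s t)) 0)) 0 := by
  have hU : IsOpen (G.μ ⁻¹' Sᶜ) := hS.isOpen_compl.preimage G.smooth_μ.continuous
  have hmem : ∀ t, F 0 t ∈ G.μ ⁻¹' Sᶜ := fun t => by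
    change G.μ (F 0 t) ∉ S
    rw [hF0]
    rwa [orbitCurve, G.μ_smul]
  have hu : ContDiff ℝ ∞ (fun q : ℝ × ℝ => G.μ (F q.1 q.2)) :=
    contMDiff_iff_contDiff.1 (G.smooth_μ.comp hF)
  have hDc : Continuous fun t => fderiv ℝ φ (G.μ x) (deriv (fun s => G.μ (F s t)) 0) := by
    have : (fun t => deriv (fun s => G.μ (F s t)) 0)
        = fun t => fderiv ℝ (fun q : ℝ × ℝ => G.μ (F q.1 q.2)) (0, t) (1, 0) := by
      funext t
      exact ((hu.differentiable (by simp) (0, t)).hasFDerivAt.comp_hasDerivAt (0 : ℝ)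
        ((hasDerivAt_id (0 : ℝ)).prodMk (hasDerivAt_const (0 : ℝ) t))).deriv
    refine (fderiv ℝ φ (G.μ x)).continuous.comp ?_
    rw [this]
    exact ((hu.continuous_fderiv (by simp)).comp (by fun_prop : Continuous fun t : ℝ =>
      ((0 : ℝ), t))).clm_apply continuous_const
  set A : ℝ → ℝ := fun t => G.η (F 0 t) (velocity (fun s => F s t) 0) with hA
  have hAs : ContDiff ℝ ∞ A := contDiff_iff_contDiffAt.2 fun t =>
    (contDiffAt_form_apply hU G.smooth_η (contMDiff_velocity_fst hF) (q := (0, t)) (hmem t)).comp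
      t (contDiff_prodMk_right (0 : ℝ)).contDiffAt
  have hA0 : ∀ c, (∀ s, F s c = orbitCurve x c) → A c = 0 := fun c hc => by
    simp only [hA]
    rw [velocity_eq_zero_of_const hc, map_zero]
  have hAc : Continuous (deriv A) := hAs.continuous_deriv (by simp)
  -- The variation field vanishes at both ends, so the total derivative integrates to zero.
  have hAi : ∫ t in a..b, deriv A t = 0 := by
    rw [intervalIntegral.integral_deriv_eq_sub
      (fun t _ => hAs.differentiable (by simp) t) (hAc.intervalIntegrable _ _),
      hA0 a ha, hA0 b hb, sub_zero]
  have h := hasDerivAt_integral_of_contDiff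
    ((contDiff_energyDensity G.g hF).of_le (by exact_mod_cast le_top)) a b 0
  refine h.congr_deriv ?_
  simp_rw [(G.hasDerivAt_energyDensity hS hx hφ hφ0 hF hF0 _).deriv]
  rw [intervalIntegral.integral_add
    (by exact (continuous_const.mul hDc).intervalIntegrable _ _)
    (by exact (continuous_const.mul hAc).intervalIntegrable _ _),
    intervalIntegral.integral_const_mul, intervalIntegral.integral_const_mul, hAi, mul_zero,
    add_zero]

lemma GibbonsHawkingSpace.contMDiff_orbitCurve (G : GibbonsHawkingSpace X S φ) (x : X) :
    ContMDiff 𝓘(ℝ, ℝ) (𝓡 4) ∞ (orbitCurve x) := by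
  have := G.smooth_smul.contMDiff_smul.comp (contMDiff_circleExp.prodMk
    (contMDiff_const (c := x) (I := 𝓘(ℝ, ℝ)) (I' := 𝓡 4) (M := ℝ) (n := ∞)))
  exact this

omit [MulAction Circle X] in
/-- Through every point of the manifold, in every direction up to scale, there is a smooth curve;
here the direction is tested against smooth maps to Euclidean space. -/
lemma exists_smooth_curve (x : X) (v : TangentSpace (𝓡 4) x) :
    ∃ (c : ℝ → X) (r : ℝ), 0 < r ∧ ContMDiff 𝓘(ℝ, ℝ) (𝓡 4) ∞ c ∧ c 0 = x ∧
      ∀ μ : X → E3, ContMDiff (𝓡 4) 𝓘(ℝ, E3) ∞ μ →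
        HasDerivAt (fun s => μ (c s)) (r • differential μ x v) 0 := by
  set y : E4 := extChartAt (𝓡 4) x x with hy
  let v' : E4 := v
  have hT : IsOpen (extChartAt (𝓡 4) x).target := isOpen_extChartAt_target x
  have hyT : y ∈ (extChartAt (𝓡 4) x).target := mem_extChartAt_target x
  obtain ⟨ε, hε, hball⟩ := Metric.isOpen_iff.1 hT y hyT
  -- The `+ 1` keeps the denominator nonzero when `v = 0`.
  set r : ℝ := ε / (2 * (‖v'‖ + 1)) with hr
  have hv1 : 0 < ‖v'‖ + 1 := by positivity
  have hr0 : 0 < r := by positivity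
  -- The bounded function `sin` keeps the curve inside the chart for all `s`, while its derivative
  -- at `0` is `1`.
  let l : ℝ → E4 := fun s => y + (r * Real.sin s) • v'
  have hl : ContDiff ℝ ∞ l :=
    contDiff_const.add ((contDiff_const.mul Real.contDiff_sin).smul contDiff_const)
  have hlT : ∀ s, l s ∈ (extChartAt (𝓡 4) x).target := fun s => by
    apply hball
    rw [Metric.mem_ball, dist_eq_norm]
    have : l s - y = (r * Real.sin s) • v' := by simp [l]
    rw [this, norm_smul, norm_mul, Real.norm_eq_abs, abs_of_pos hr0, Real.norm_eq_abs]
    calc r * |Real.sin s| * ‖v'‖ ≤ r * 1 * (‖v'‖ + 1) := by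
          gcongr
          · exact Real.abs_sin_le_one s
          · linarith
      _ = ε / 2 := by rw [hr]; field_simp
      _ < ε := by linarith
  have hl0 : l 0 = y := by simp [l]
  refine ⟨fun s => (extChartAt (𝓡 4) x).symm (l s), r, hr0, ?_, ?_, fun μ hμ => ?_⟩
  · exact (contMDiffOn_extChartAt_symm x).comp_contMDiff hl.contMDiff hlT
  · change (extChartAt (𝓡 4) x).symm (l 0) = x
    rw [hl0]
    exact extChartAt_to_inv x
  · have hmd : MDifferentiableAt (𝓡 4) 𝓘(ℝ, E3) μ x := (hμ x).mdifferentiableAt (by simp)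
    have hd : HasFDerivAt (fun z => μ ((extChartAt (𝓡 4) x).symm z))
        (show E4 →L[ℝ] E3 from mfderiv (𝓡 4) 𝓘(ℝ, E3) μ x) (l 0) := by
      -- By definition `mfderiv` is the derivative of `μ` read in the chart at `x`, the target being
      -- a vector space.
      have h2 : HasFDerivWithinAt (fun z => μ ((extChartAt (𝓡 4) x).symm z))
          (show E4 →L[ℝ] E3 from mfderiv (𝓡 4) 𝓘(ℝ, E3) μ x) (Set.range (𝓡 4)) y :=
        hmd.hasMFDerivAt.2
      rw [modelWithCornersSelf_coe, Set.range_id, hasFDerivWithinAt_univ] at h2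
      rw [hl0]
      exact h2
    have hld : HasDerivAt l (r • v') 0 := by
      have h3 := (((Real.hasDerivAt_sin 0).const_mul r).smul_const v').const_add y
      rw [Real.cos_zero, mul_one] at h3
      exact h3
    have h4 := hd.comp_hasDerivAt (0 : ℝ) hld
    rw [map_smul] at h4
    exact h4

/-- The moment map is a submersion over the complement of `S`. -/
lemma GibbonsHawkingSpace.differential_surjective (G : GibbonsHawkingSpace X S φ) {x : X}
    (hx : G.μ x ∉ S) (e : E3) : ∃ v, differential G.μ x v = e := by
  -- Positivity of `g` makes `(η, dμ)` injective, and `4 = 1 + 3` makes it bijective.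
  let L : E4 →ₗ[ℝ] ℝ × E3 := LinearMap.prod (show E4 →L[ℝ] ℝ from G.η x).toLinearMap
    (show E4 →L[ℝ] E3 from mfderiv (𝓡 4) 𝓘(ℝ, E3) G.μ x).toLinearMap
  have hinj : Function.Injective L := by
    rw [← LinearMap.ker_eq_bot, LinearMap.ker_eq_bot']
    intro v hv
    have h1 : G.η x v = 0 := congrArg Prod.fst hv
    have h2 : differential G.μ x v = 0 := congrArg Prod.snd hv
    by_contra hne
    have h3 := G.g.pos x v hne
    have h4 := G.metric_eq x hx v v
    rw [h1, h2, inner_zero_left, mul_zero, mul_zero, mul_zero, add_zero] at h4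
    exact h3.ne' h4
  have hsurj : Function.Surjective L :=
    (LinearMap.injective_iff_surjective_of_finrank_eq_finrank (by simp)).1 hinj
  obtain ⟨v, hv⟩ := hsurj (0, e)
  exact ⟨v, congrArg Prod.snd hv⟩

/-- An orbit over the complement of `S` is a geodesic if and only if it lies over a critical point
of `φ`. -/
theorem GibbonsHawkingSpace.isGeodesic_orbitCurve_iff (G : GibbonsHawkingSpace X S φ)
    (hS : IsClosed S) {x : X} (hx : G.μ x ∉ S) (hφ : DifferentiableAt ℝ φ (G.μ x))
    (hφ0 : φ (G.μ x) ≠ 0) :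
    IsGeodesic G.g (orbitCurve x) ↔ fderiv ℝ φ (G.μ x) = 0 := by
  constructor
  · rintro ⟨-, hgeo⟩
    ext e
    obtain ⟨v, rfl⟩ := G.differential_surjective hx e
    obtain ⟨c, r, hr, hc, hc0, hcμ⟩ := exists_smooth_curve x v
    -- The factor `t (1 - t)` fixes the ends on `[0, 1]`; rotating by `exp t` is invisible to `μ`,
    -- so `∂ₛ μ` is that multiple of one fixed vector.
    let F : ℝ → ℝ → X := fun s t => Circle.exp t • c (s * (t * (1 - t)))
    have hF : ContMDiff 𝓘(ℝ, ℝ × ℝ) (𝓡 4) ∞ (fun q : ℝ × ℝ => F q.1 q.2) := by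
      have h1 : ContMDiff 𝓘(ℝ, ℝ × ℝ) (𝓡 1) ∞ (fun q : ℝ × ℝ => Circle.exp q.2) :=
        contMDiff_circleExp.comp contDiff_snd.contMDiff
      have h2 : ContMDiff 𝓘(ℝ, ℝ × ℝ) (𝓡 4) ∞
          (fun q : ℝ × ℝ => c (q.1 * (q.2 * (1 - q.2)))) :=
        hc.comp (contDiff_fst.mul (contDiff_snd.mul (contDiff_const.sub contDiff_snd))).contMDiff
      exact G.smooth_smul.contMDiff_smul.comp (h1.prodMk h2)
    have hF0 : ∀ t, F 0 t = orbitCurve x t := fun t => by simp [F, hc0, orbitCurve]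
    have ha : ∀ s, F s 0 = orbitCurve x 0 := fun s => by simp [F, hc0, orbitCurve]
    have hb : ∀ s, F s 1 = orbitCurve x 1 := fun s => by simp [F, hc0, orbitCurve]
    have h := (hgeo 0 1 one_pos F hF hF0 ha hb).unique
      (G.hasDerivAt_energy hS hx hφ hφ0 hF hF0 ha hb)
    have hder : ∀ t, deriv (fun s => G.μ (F s t)) 0
        = (t * (1 - t) * r) • differential G.μ x v := fun t => by
      have h1 := hcμ G.μ G.smooth_μ
      rw [← zero_mul (t * (1 - t))] at h1
      have h2 := h1.scomp (0 : ℝ) ((hasDerivAt_id (0 : ℝ)).mul_const (t * (1 - t)))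
      have h3 : (fun s => G.μ (F s t)) = fun s => G.μ (c (s * (t * (1 - t)))) := by
        funext s
        exact G.μ_smul _ _
      rw [h3, mul_smul]
      simpa [Function.comp_def] using h2.deriv
    simp_rw [hder, map_smul, smul_eq_mul] at h
    rw [intervalIntegral.integral_mul_const, intervalIntegral.integral_mul_const] at h
    -- Only the nonvanishing of this integral matters.
    have hint : ∫ t in (0 : ℝ)..1, t * (1 - t) = 1 / 6 := by
      simp_rw [mul_sub, mul_one, ← pow_two]
      rw [intervalIntegral.integral_sub (by simp) (by simp), integral_id, integral_pow]
      norm_num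
    rw [hint] at h
    have hne : -(2 * φ (G.μ x) ^ 2)⁻¹ ≠ 0 := by simpa using hφ0
    have h5 := (mul_eq_zero.1 h.symm).resolve_left hne
    exact (mul_eq_zero.1 h5).resolve_left (by positivity)
  · intro hcrit
    refine ⟨G.contMDiff_orbitCurve x, fun a b _ F hF hF0 ha hb => ?_⟩
    have h := G.hasDerivAt_energy hS hx hφ hφ0 hF hF0 ha hb
    simpa [hcrit] using h

end FirstVariation

end GibbonsHawking

namespace GibbonsHawking

open Topology

/-! ### Equilibria of equal charges on a line. -/

section Line

variable {ι : Type*} [Fintype ι]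

/-- The restriction to the line of the gradient of `-2 ∑ i, 1 / (2 |x - s i|)`: the force exerted at
`τ` by equal unit charges at the points `s i`. -/
noncomputable def lineForce (s : ι → ℝ) (τ : ℝ) : ℝ := ∑ i, (τ - s i) / |τ - s i| ^ 3

lemma div_abs_cube_of_pos {y : ℝ} (hy : 0 < y) : y / |y| ^ 3 = (y ^ 2)⁻¹ := by
  rw [abs_of_pos hy]
  field_simp

lemma div_abs_cube_of_neg {y : ℝ} (hy : y < 0) : y / |y| ^ 3 = -(y ^ 2)⁻¹ := by
  rw [abs_of_neg hy]
  have := hy.ne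
  field_simp

lemma div_abs_cube_lt_of_pos {y z : ℝ} (hy : 0 < y) (hyz : y < z) :
    z / |z| ^ 3 < y / |y| ^ 3 := by
  rw [div_abs_cube_of_pos hy, div_abs_cube_of_pos (hy.trans hyz)]
  gcongr

lemma div_abs_cube_lt_of_neg {y z : ℝ} (hz : z < 0) (hyz : y < z) :
    z / |z| ^ 3 < y / |y| ^ 3 := by
  rw [div_abs_cube_of_neg hz, div_abs_cube_of_neg (hyz.trans hz), neg_lt_neg_iff]
  have : 0 < z ^ 2 := by have := hz.ne; positivity
  exact inv_strictAnti₀ this (by nlinarith)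

lemma continuousAt_div_abs_cube (c : ℝ) {τ : ℝ} (h : τ ≠ c) :
    ContinuousAt (fun τ => (τ - c) / |τ - c| ^ 3) τ := by
  have : |τ - c| ^ 3 ≠ 0 := by
    have := sub_ne_zero.2 h
    positivity
  fun_prop (disch := assumption)

/-- Each summand `y / |y| ^ 3` decreases on either side of its own charge, and no charge separates
the points of the interval. -/
lemma lineForce_strictAntiOn [Nonempty ι] (s : ι → ℝ) {a b : ℝ}
    (h : ∀ l, s l ∉ Set.Ioo a b) : StrictAntiOn (lineForce s) (Set.Ioo a b) := by
  intro x hx y hy hxy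
  refine Finset.sum_lt_sum_of_nonempty Finset.univ_nonempty fun l _ => ?_
  rcases le_or_gt (s l) a with hl | hl
  · exact div_abs_cube_lt_of_pos (by linarith [hx.1]) (by linarith)
  · have : b ≤ s l := not_lt.1 fun hlb => h l ⟨hl, hlb⟩
    exact div_abs_cube_lt_of_neg (by linarith [hy.2]) (by linarith)

/-- This reflection exchanges left and right, so each one-sided statement need be proved only once.
-/
lemma lineForce_neg (s : ι → ℝ) (τ : ℝ) :
    lineForce (fun i => -s i) (-τ) = -lineForce s τ := by
  unfold lineForce
  rw [← Finset.sum_neg_distrib]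
  refine Finset.sum_congr rfl fun i _ => ?_
  rw [show -τ - -s i = -(τ - s i) by ring, abs_neg, neg_div]

/-- Just to the right of `s i` the repulsion of that charge tends to `+∞`, while the other charges
contribute a continuous, hence locally bounded, force. -/
lemma exists_lineForce_pos {s : ι → ℝ} (hs : Function.Injective s) (i : ι) {b : ℝ}
    (hb : s i < b) : ∃ τ ∈ Set.Ioo (s i) b, 0 < lineForce s τ := by
  classical
  have h1 : Filter.Tendsto (fun τ => (τ - s i) / |τ - s i| ^ 3) (𝓝[>] (s i)) Filter.atTop := by
    have h2 : Filter.Tendsto (fun τ : ℝ => (τ - s i) ^ 2) (𝓝[>] (s i)) (𝓝[>] 0) := by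
      refine tendsto_nhdsWithin_iff.2 ⟨?_, ?_⟩
      · have : ContinuousAt (fun τ : ℝ => (τ - s i) ^ 2) (s i) := by fun_prop
        have h3 := this.tendsto.mono_left (nhdsWithin_le_nhds (s := Set.Ioi (s i)))
        simpa using h3
      · filter_upwards [self_mem_nhdsWithin] with τ hτ
        have : 0 < τ - s i := sub_pos.2 hτ
        exact pow_pos this 2
    refine (tendsto_inv_nhdsGT_zero.comp h2).congr' ?_
    filter_upwards [self_mem_nhdsWithin] with τ hτ
    exact (div_abs_cube_of_pos (sub_pos.2 hτ)).symm
  have h4 : ContinuousAt (fun τ => ∑ l ∈ Finset.univ.erase i, (τ - s l) / |τ - s l| ^ 3)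
      (s i) :=
    tendsto_finsetSum _ fun l hl =>
      continuousAt_div_abs_cube (s l) (hs.ne (Finset.ne_of_mem_erase hl).symm)
  have h5 := h1.atTop_add (h4.tendsto.mono_left nhdsWithin_le_nhds)
  obtain ⟨τ, hτ, hτ'⟩ := ((h5.eventually_gt_atTop 0).and (Ioo_mem_nhdsGT hb)).exists
  refine ⟨τ, hτ', ?_⟩
  unfold lineForce
  rwa [← Finset.add_sum_erase _ _ (Finset.mem_univ i)]

lemma exists_lineForce_neg {s : ι → ℝ} (hs : Function.Injective s) (j : ι) {a : ℝ}
    (ha : a < s j) : ∃ τ ∈ Set.Ioo a (s j), lineForce s τ < 0 := by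
  obtain ⟨τ, hτ, h⟩ := exists_lineForce_pos (s := fun i => -s i) (neg_injective.comp hs) j
    (neg_lt_neg ha)
  refine ⟨-τ, ⟨by linarith [hτ.2], by linarith [hτ.1]⟩, ?_⟩
  have := lineForce_neg s (-τ)
  rw [neg_neg] at this
  linarith

/-- Between two consecutive charges there is exactly one point of equilibrium. -/
lemma existsUnique_lineForce_eq_zero {s : ι → ℝ} (hs : Function.Injective s) {i j : ι}
    (hij : s i < s j) (h : ∀ l, s l ∉ Set.Ioo (s i) (s j)) :
    ∃! τ, τ ∈ Set.Ioo (s i) (s j) ∧ lineForce s τ = 0 := by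
  have : Nonempty ι := ⟨i⟩
  obtain ⟨x, hx, hx0⟩ := exists_lineForce_pos hs i hij
  obtain ⟨y, hy, hy0⟩ := exists_lineForce_neg hs j hij
  have hc : ContinuousOn (lineForce s) (Set.Ioo (s i) (s j)) := fun τ hτ =>
    ContinuousAt.continuousWithinAt <| tendsto_finsetSum _ fun l _ =>
      continuousAt_div_abs_cube (s l) (by rintro rfl; exact h l hτ)
  obtain ⟨τ, hτ, hτ0⟩ := isPreconnected_Ioo.intermediate_value hy hx hc ⟨hy0.le, hx0.le⟩
  exact ⟨τ, ⟨hτ, hτ0⟩, fun z hz =>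
    (lineForce_strictAntiOn s h).injOn hz.1 hτ (hz.2.trans hτ0.symm)⟩

/-- A point of equilibrium lies to the right of some charge. -/
lemma exists_lt_of_lineForce_eq_zero [Nonempty ι] {s : ι → ℝ} {τ : ℝ} (hτ : τ ∉ Set.range s)
    (h0 : lineForce s τ = 0) : ∃ i, s i < τ := by
  by_contra! hcon
  refine h0.not_lt (Finset.sum_neg (fun i _ => ?_) Finset.univ_nonempty)
  have : τ - s i < 0 := sub_neg.2 (lt_of_le_of_ne (hcon i) fun h => hτ ⟨i, h.symm⟩)
  rw [div_abs_cube_of_neg this, neg_lt_zero]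
  have := this.ne
  positivity

/-- A point of equilibrium lies to the left of some charge. -/
lemma exists_gt_of_lineForce_eq_zero [Nonempty ι] {s : ι → ℝ} {τ : ℝ} (hτ : τ ∉ Set.range s)
    (h0 : lineForce s τ = 0) : ∃ i, τ < s i := by
  obtain ⟨i, hi⟩ := exists_lt_of_lineForce_eq_zero (s := fun i => -s i) (τ := -τ)
    (by rintro ⟨i, hi⟩; exact hτ ⟨i, neg_injective hi⟩) (by rw [lineForce_neg, h0, neg_zero])
  exact ⟨i, neg_lt_neg_iff.1 hi⟩

/-- Every point of equilibrium lies between two consecutive charges. -/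
lemma exists_consecutive_of_lineForce_eq_zero [Nonempty ι] {s : ι → ℝ} {τ : ℝ}
    (hτ : τ ∉ Set.range s) (h0 : lineForce s τ = 0) :
    ∃ i j, s i < s j ∧ (∀ l, s l ∉ Set.Ioo (s i) (s j)) ∧ τ ∈ Set.Ioo (s i) (s j) := by
  classical
  obtain ⟨i₀, hi₀⟩ := exists_lt_of_lineForce_eq_zero hτ h0
  obtain ⟨j₀, hj₀⟩ := exists_gt_of_lineForce_eq_zero hτ h0
  -- The nearest charges on either side of `τ` are consecutive.
  obtain ⟨i, hi, himax⟩ := Finset.exists_max_image (Finset.univ.filter fun i => s i < τ) s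
    ⟨i₀, by simpa using hi₀⟩
  obtain ⟨j, hj, hjmin⟩ := Finset.exists_min_image (Finset.univ.filter fun i => τ < s i) s
    ⟨j₀, by simpa using hj₀⟩
  simp only [Finset.mem_filter, Finset.mem_univ, true_and] at hi hj himax hjmin
  refine ⟨i, j, hi.trans hj, fun l hl => ?_, hi, hj⟩
  rcases lt_trichotomy (s l) τ with h | h | h
  · exact (himax l h).not_gt hl.1
  · exact hτ ⟨l, h⟩
  · exact (hjmin l h).not_gt hl.2

/-- The number of points of equilibrium of `k` equal charges on a line. -/
lemma encard_lineForce_eq_zero {k : ℕ} (hk : 0 < k) {s : Fin k → ℝ} (hs : Function.Injective s) :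
    {τ | τ ∉ Set.range s ∧ lineForce s τ = 0}.encard = ((k - 1 : ℕ) : ℕ∞) := by
  obtain ⟨n, rfl⟩ : ∃ n, k = n + 1 := ⟨k - 1, by omega⟩
  set t : Fin (n + 1) → ℝ := s ∘ Tuple.sort s with ht
  have htm : StrictMono t :=
    (Tuple.monotone_sort s).strictMono_of_injective (hs.comp (Tuple.sort s).injective)
  have hrange : Set.range t = Set.range s := (Tuple.sort s).surjective.range_comp s
  have hforce : lineForce t = lineForce s := by
    funext τ
    exact Equiv.sum_comp (Tuple.sort s) fun i => (τ - s i) / |τ - s i| ^ 3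
  have hgap : ∀ i : Fin n, ∀ l, t l ∉ Set.Ioo (t i.castSucc) (t i.succ) := by
    rintro i l ⟨h1, h2⟩
    have h1 := htm.lt_iff_lt.1 h1
    have h2 := htm.lt_iff_lt.1 h2
    simp only [Fin.lt_def, Fin.val_castSucc, Fin.val_succ] at h1 h2
    omega
  choose z hz hzu using fun i : Fin n =>
    existsUnique_lineForce_eq_zero htm.injective (htm i.castSucc_lt_succ) (hgap i)
  -- Distinct gaps are separated by a charge, so their zeros are distinct.
  have hzm : StrictMono z := fun i j hij =>
    ((hz i).1.2.trans_le (htm.monotone (Fin.succ_le_castSucc_iff.2 hij))).trans (hz j).1.1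
  -- Excluding the charges matters: at a charge its own term is `0 / 0 = 0`, so the middle one of
  -- three equally spaced charges would be counted too.
  have hset : {τ | τ ∉ Set.range s ∧ lineForce s τ = 0} = Set.range z := by
    rw [← hrange, ← hforce]
    ext τ
    constructor
    · rintro ⟨h1, h2⟩
      obtain ⟨i, j, hij, hl, hτ⟩ := exists_consecutive_of_lineForce_eq_zero h1 h2
      have hij' := htm.lt_iff_lt.1 hij
      have hin : (i : ℕ) < n := by
        have := j.isLt
        rw [Fin.lt_def] at hij'
        omega
      have hi : i = (⟨i, hin⟩ : Fin n).castSucc := rfl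
      have hj : j = (⟨i, hin⟩ : Fin n).succ := by
        by_contra hne
        -- If `j` were beyond `i + 1`, that intermediate charge would lie in the gap.
        refine hl (⟨i, hin⟩ : Fin n).succ ⟨htm ?_, htm ?_⟩
        · rw [Fin.lt_def, Fin.val_succ]
          simp
        · rw [Fin.lt_def] at hij' ⊢
          have : (j : ℕ) ≠ i + 1 := fun h => hne (Fin.ext h)
          simp only [Fin.val_succ]
          omega
      rw [hi, hj] at hτ
      exact ⟨_, (hzu _ τ ⟨hτ, h2⟩).symm⟩
    · rintro ⟨i, rfl⟩
      exact ⟨by rintro ⟨l, hl⟩; exact hgap i l (hl ▸ (hz i).1), (hz i).2⟩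
  rw [hset, ← Set.image_univ, hzm.injective.encard_image, Set.encard_univ]
  simp

end Line

end GibbonsHawking

namespace GibbonsHawking

/-! ### Critical points of the potential of collinear points. -/

section Critical

variable {k : ℕ} {m : ℝ} {p : Fin k → E3}

lemma hasFDerivAt_inv_two_norm {x c : E3} (h : x ≠ c) :
    HasFDerivAt (fun x : E3 => 1 / (2 * ‖x - c‖))
      ((-(1 / 2 : ℝ)) • innerSL ℝ ((‖x - c‖ ^ 3)⁻¹ • (x - c))) x := by
  have hr : ‖x - c‖ ≠ 0 := norm_ne_zero_iff.2 (sub_ne_zero.2 h)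
  -- The norm is differentiated as the square root of the squared norm, which is nonzero here.
  have h1 : HasFDerivAt (fun x : E3 => √(‖x - c‖ ^ 2)) _ x :=
    ((hasFDerivAt_id x).sub_const c).norm_sq.sqrt (pow_ne_zero 2 hr)
  simp only [Real.sqrt_sq (norm_nonneg _)] at h1
  have h2 : HasDerivAt (fun y : ℝ => 1 / (2 * y)) (-(2 / (2 * ‖x - c‖) ^ 2)) ‖x - c‖ := by
    have h3 := ((hasDerivAt_id ‖x - c‖).const_mul 2).inv (mul_ne_zero two_ne_zero hr)
    simp only [one_div]
    exact h3.congr_deriv (by simp [neg_div])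
  refine (h2.comp_hasFDerivAt x h1).congr_fderiv ?_
  ext e
  simp
  field_simp

lemma hasFDerivAt_potential {q : E3} (hq : q ∉ Set.range p) :
    HasFDerivAt (potential m p)
      ((-(1 / 2 : ℝ)) • innerSL ℝ (∑ i, (‖q - p i‖ ^ 3)⁻¹ • (q - p i))) q := by
  have h := (HasFDerivAt.fun_sum (u := Finset.univ) fun i _ =>
    hasFDerivAt_inv_two_norm (x := q) (c := p i) fun h => hq ⟨i, h.symm⟩).const_add m
  refine h.congr_fderiv ?_
  rw [map_sum, Finset.smul_sum]

lemma potential_pos (hm : 0 ≤ m) (hk : 0 < k) {q : E3} (hq : q ∉ Set.range p) :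
    0 < potential m p q := by
  refine add_pos_of_nonneg_of_pos hm (Finset.sum_pos (fun i _ => ?_) ⟨⟨0, hk⟩, by simp⟩)
  have : 0 < ‖q - p i‖ := norm_pos_iff.2 (sub_ne_zero.2 fun h => hq ⟨i, h.symm⟩)
  positivity

lemma fderiv_potential_eq_zero_iff {q : E3} (hq : q ∉ Set.range p) :
    fderiv ℝ (potential m p) q = 0 ↔ ∑ i, (‖q - p i‖ ^ 3)⁻¹ • (q - p i) = 0 := by
  rw [(hasFDerivAt_potential hq).fderiv, smul_eq_zero, ← (innerSL ℝ).map_zero]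
  constructor
  · intro h
    have := h.resolve_left (by norm_num)
    -- `innerSL` preserves norms, hence is injective.
    have h2 := congrArg norm this
    rw [map_zero, norm_zero, innerSL_apply_norm, norm_eq_zero] at h2
    exact h2
  · intro h
    right
    rw [h]

/-- Parametrization of the line through a family of distinct collinear points. -/
lemma exists_line_param (hk : 2 ≤ k) (hp : Function.Injective p)
    (hcol : Collinear ℝ (Set.range p)) :
    ∃ (P : ℝ →ᵃ[ℝ] E3) (v : E3) (s : Fin k → ℝ), v ≠ 0 ∧ (∀ τ, P τ = P 0 + τ • v) ∧
      ∀ i, p i = P (s i) := by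
  let i₀ : Fin k := ⟨0, by omega⟩
  let i₁ : Fin k := ⟨1, by omega⟩
  obtain ⟨v, hv⟩ := (collinear_iff_of_mem (Set.mem_range_self i₀)).1 hcol
  choose s hs using fun i => hv (p i) (Set.mem_range_self i)
  have hP : ∀ τ : ℝ, AffineMap.lineMap (p i₀) (p i₀ + v) τ = p i₀ + τ • v := fun τ => by
    rw [AffineMap.lineMap_apply]
    simp [add_comm]
  refine ⟨AffineMap.lineMap (p i₀) (p i₀ + v), v, s, ?_, fun τ => ?_, fun i => ?_⟩
  · rintro rfl
    have : i₀ = i₁ := hp (by rw [hs i₁]; simp)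
    simp [i₀, i₁] at this
  · rw [hP, hP]
    simp
  · rw [hP, hs i, vadd_eq_add, add_comm]

lemma line_param_injective {P : ℝ →ᵃ[ℝ] E3} {v : E3} (hv : v ≠ 0)
    (hP : ∀ τ, P τ = P 0 + τ • v) : Function.Injective P := by
  intro a b hab
  rw [hP a, hP b] at hab
  exact smul_left_injective ℝ hv (add_left_cancel hab)

/-- The critical points of the potential of collinear points are on their line, at the points of
equilibrium. -/
lemma critical_iff_of_line {P : ℝ →ᵃ[ℝ] E3} {v : E3} {s : Fin k → ℝ} (hk : 0 < k) (hv : v ≠ 0)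
    (hP : ∀ τ, P τ = P 0 + τ • v) (hs : ∀ i, p i = P (s i)) (q : E3) :
    (q ∉ Set.range p ∧ fderiv ℝ (potential m p) q = 0) ↔
      ∃ τ, (τ ∉ Set.range s ∧ lineForce s τ = 0) ∧ P τ = q := by
  have hinj := line_param_injective hv hP
  have hmem : ∀ τ, P τ ∈ Set.range p ↔ τ ∈ Set.range s := fun τ => by
    simp only [Set.mem_range, hs, hinj.eq_iff]
  have hsum : ∀ τ, ∑ i, (‖P τ - p i‖ ^ 3)⁻¹ • (P τ - p i)
      = ((‖v‖ ^ 3)⁻¹ * lineForce s τ) • v := fun τ => by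
    rw [lineForce, Finset.mul_sum, Finset.sum_smul]
    refine Finset.sum_congr rfl fun i _ => ?_
    have : P τ - p i = (τ - s i) • v := by
      rw [hs i, hP τ, hP (s i), add_sub_add_left_eq_sub, sub_smul]
    rw [this, norm_smul, smul_smul, Real.norm_eq_abs, mul_pow, mul_inv]
    congr 1
    ring
  have hv3 : (‖v‖ ^ 3)⁻¹ ≠ 0 := by
    have := norm_ne_zero_iff.2 hv
    positivity
  constructor
  · rintro ⟨hq, h0⟩
    rw [fderiv_potential_eq_zero_iff hq] at h0
    set c : Fin k → ℝ := fun i => (‖q - p i‖ ^ 3)⁻¹ with hc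
    have hcpos : 0 < ∑ i, c i := by
      refine Finset.sum_pos (fun i _ => ?_) ⟨⟨0, hk⟩, by simp⟩
      have : 0 < ‖q - p i‖ := norm_pos_iff.2 (sub_ne_zero.2 fun h => hq ⟨i, h.symm⟩)
      positivity
    -- The vanishing gradient, solved for `q`: it is the barycentre of the `p i` with weights `c i >
    -- 0`, so its parameter is the weighted mean of the `s i`.
    have h1 : (∑ i, c i) • (q - P 0) = (∑ i, c i * s i) • v := by
      rw [← sub_eq_zero, ← h0, Finset.sum_smul, Finset.sum_smul, ← Finset.sum_sub_distrib]
      refine Finset.sum_congr rfl fun i _ => ?_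
      change _ = c i • (q - p i)
      rw [mul_smul, ← smul_sub, hs i, hP (s i), sub_sub]
    have h2 : P ((∑ i, c i)⁻¹ * ∑ i, c i * s i) = q := by
      rw [hP, mul_smul, ← h1, smul_smul, inv_mul_cancel₀ hcpos.ne', one_smul,
        add_sub_cancel]
    refine ⟨_, ⟨?_, ?_⟩, h2⟩
    · rwa [← hmem, h2]
    · have h3 := hsum ((∑ i, c i)⁻¹ * ∑ i, c i * s i)
      rw [h2, h0] at h3
      exact (mul_eq_zero.1 ((smul_eq_zero.1 h3.symm).resolve_right hv)).resolve_left hv3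
  · rintro ⟨τ, ⟨h1, h2⟩, rfl⟩
    have h3 : P τ ∉ Set.range p := by rwa [hmem]
    refine ⟨h3, ?_⟩
    rw [fderiv_potential_eq_zero_iff h3, hsum, h2, mul_zero, zero_smul]

lemma mem_openSegment_line_iff {P : ℝ →ᵃ[ℝ] E3} (hP : Function.Injective P) (a b τ : ℝ) :
    P τ ∈ openSegment ℝ (P a) (P b) ↔ τ ∈ openSegment ℝ a b := by
  rw [← image_openSegment, hP.mem_set_image]

/-- Adjacency of points of a line, in terms of a parameter. -/
lemma adjacent_iff_of_line {P : ℝ →ᵃ[ℝ] E3} (hP : Function.Injective P) {s : Fin k → ℝ}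
    (hs : ∀ i, p i = P (s i)) (i j : Fin k) :
    Adjacent p i j ↔ s i ≠ s j ∧ ∀ l, s l ∉ openSegment ℝ (s i) (s j) := by
  simp only [Adjacent, hs, hP.ne_iff, mem_openSegment_line_iff hP]

/-- The critical points of the potential of collinear points: there are `k - 1` of them, each lies
between two adjacent points, and there is exactly one between two given adjacent points. -/
theorem critical_points_potential (hk : 2 ≤ k) (hp : Function.Injective p)
    (hcol : Collinear ℝ (Set.range p)) :
    {q | q ∉ Set.range p ∧ fderiv ℝ (potential m p) q = 0}.encard = ((k - 1 : ℕ) : ℕ∞) ∧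
    (∀ q, q ∉ Set.range p ∧ fderiv ℝ (potential m p) q = 0 →
      ∃ i j, Adjacent p i j ∧ q ∈ openSegment ℝ (p i) (p j)) ∧
    (∀ i j, Adjacent p i j → ∃! q, (q ∉ Set.range p ∧ fderiv ℝ (potential m p) q = 0) ∧
      q ∈ openSegment ℝ (p i) (p j)) := by
  obtain ⟨P, v, s, hv, hP, hs⟩ := exists_line_param hk hp hcol
  have hinj := line_param_injective hv hP
  have hsinj : Function.Injective s := fun i j hij => hp (by rw [hs, hs, hij])
  have : Nonempty (Fin k) := ⟨⟨0, by omega⟩⟩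
  have hcrit := critical_iff_of_line (m := m) (by omega) hv hP hs
  refine ⟨?_, ?_, ?_⟩
  · have : {q | q ∉ Set.range p ∧ fderiv ℝ (potential m p) q = 0}
        = P '' {τ | τ ∉ Set.range s ∧ lineForce s τ = 0} := Set.ext hcrit
    rw [this, hinj.encard_image, encard_lineForce_eq_zero (by omega) hsinj]
  · intro q hq
    obtain ⟨τ, ⟨h1, h2⟩, rfl⟩ := (hcrit q).1 hq
    obtain ⟨i, j, hij, hl, hτ⟩ := exists_consecutive_of_lineForce_eq_zero h1 h2
    rw [← openSegment_eq_Ioo hij] at hτ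
    refine ⟨i, j, (adjacent_iff_of_line hinj hs i j).2 ⟨hij.ne, fun l => ?_⟩, ?_⟩
    · rw [openSegment_eq_Ioo hij]
      exact hl l
    · rwa [hs i, hs j, mem_openSegment_line_iff hinj]
  · intro i j hadj
    rw [adjacent_iff_of_line hinj hs] at hadj
    have key : ∃! τ, τ ∈ openSegment ℝ (s i) (s j) ∧ lineForce s τ = 0 := by
      rcases hadj.1.lt_or_gt with h | h
      · rw [openSegment_eq_Ioo h] at hadj ⊢
        exact existsUnique_lineForce_eq_zero hsinj h hadj.2
      · rw [openSegment_symm, openSegment_eq_Ioo h] at hadj ⊢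
        exact existsUnique_lineForce_eq_zero hsinj h hadj.2
    obtain ⟨τ, ⟨hτ, h0⟩, huniq⟩ := key
    refine ⟨P τ, ⟨(hcrit _).2 ⟨τ, ⟨?_, h0⟩, rfl⟩, ?_⟩, ?_⟩
    · rintro ⟨l, rfl⟩
      exact hadj.2 l hτ
    · rwa [hs i, hs j, mem_openSegment_line_iff hinj]
    · rintro q ⟨hq, hseg⟩
      obtain ⟨σ, ⟨-, hσ⟩, rfl⟩ := (hcrit q).1 hq
      rw [hs i, hs j, mem_openSegment_line_iff hinj] at hseg
      rw [huniq σ ⟨hseg, hσ⟩]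

end Critical

/-! ### Geodesic orbits as fibres over critical points. -/

section Orbits

variable {X : Type*} [TopologicalSpace X] [ChartedSpace E4 X] [IsManifold (𝓡 4) ∞ X]
  [MulAction Circle X] {S : Set E3} {φ : E3 → ℝ}

lemma GibbonsHawkingSpace.mem_fixedPoints_iff (G : GibbonsHawkingSpace X S φ) (x : X) :
    x ∈ MulAction.fixedPoints Circle X ↔ G.μ x ∈ S := by
  constructor
  · intro h
    by_contra hx
    -- Any nontrivial element of the circle contradicts freeness; `-1` is the simplest.
    have h1 : (-1 : Circle) = 1 := G.free x hx (-1) (h (-1))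
    have h2 := congrArg (fun z : Circle => (z : ℂ).re) h1
    norm_num at h2
  · exact fun h c => G.fixed x h c

lemma GibbonsHawkingSpace.orbit_eq (G : GibbonsHawkingSpace X S φ) (x : X) :
    MulAction.orbit Circle x = G.μ ⁻¹' {G.μ x} :=
  Set.ext fun y => (G.fibre_eq_orbit x y).symm

/-- The geodesic orbits are the fibres of the moment map over the critical points of `φ`. -/
theorem GibbonsHawkingSpace.isGeodesicOrbit_iff (G : GibbonsHawkingSpace X S φ) (hS : IsClosed S)
    (hφ : ∀ q ∉ S, DifferentiableAt ℝ φ q) (hφ0 : ∀ q ∉ S, φ q ≠ 0) (O : Set X) :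
    IsGeodesicOrbit G.g O ↔ ∃ q, (q ∉ S ∧ fderiv ℝ φ q = 0) ∧ G.μ ⁻¹' {q} = O := by
  constructor
  · rintro ⟨x, hx, rfl, hgeo⟩
    rw [G.mem_fixedPoints_iff] at hx
    exact ⟨G.μ x, ⟨hx, (G.isGeodesic_orbitCurve_iff hS hx (hφ _ hx) (hφ0 _ hx)).1 hgeo⟩,
      (G.orbit_eq x).symm⟩
  · rintro ⟨q, ⟨hq, h0⟩, rfl⟩
    obtain ⟨x, rfl⟩ := G.surjective_μ q
    exact ⟨x, by rwa [G.mem_fixedPoints_iff], (G.orbit_eq x).symm,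
      (G.isGeodesic_orbitCurve_iff hS hq (hφ _ hq) (hφ0 _ hq)).2 h0⟩

end Orbits

end GibbonsHawking

theorem proposition3p4 {X : Type*} [TopologicalSpace X] [T2Space X] [SecondCountableTopology X]
    [ChartedSpace GibbonsHawking.E4 X] [IsManifold (𝓡 4) ∞ X] [MulAction Circle X]
    {k : ℕ} (hk : 2 ≤ k) (p : Fin k → GibbonsHawking.E3) (hp : Function.Injective p)
    (hcol : Collinear ℝ (Set.range p)) (m : ℝ) (hm : 0 ≤ m)
    (G : GibbonsHawking.GibbonsHawkingSpace X (Set.range p) (GibbonsHawking.potential m p)) :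
    {O : Set X | GibbonsHawking.IsGeodesicOrbit G.g O}.encard = ((k - 1 : ℕ) : ℕ∞) ∧
    (∀ O : Set X, GibbonsHawking.IsGeodesicOrbit G.g O →
      ∃ i j : Fin k, GibbonsHawking.Adjacent p i j ∧
        ∃ q ∈ openSegment ℝ (p i) (p j), G.μ '' O = {q}) ∧
    (∀ i j : Fin k, GibbonsHawking.Adjacent p i j →
      ∃! O : Set X, GibbonsHawking.IsGeodesicOrbit G.g O ∧
        ∃ q ∈ openSegment ℝ (p i) (p j), G.μ '' O = {q}) := by
  have hS : IsClosed (Set.range p) := (Set.finite_range p).isClosed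
  have hiff := G.isGeodesicOrbit_iff hS
    (fun q hq => (GibbonsHawking.hasFDerivAt_potential hq).differentiableAt)
    (fun q hq => (GibbonsHawking.potential_pos hm (by omega) hq).ne')
  obtain ⟨hcard, hbetween, huniq⟩ := GibbonsHawking.critical_points_potential (m := m) hk hp hcol
  have himage : ∀ q, G.μ '' (G.μ ⁻¹' {q}) = {q} := fun q =>
    Set.image_preimage_eq _ G.surjective_μ
  refine ⟨?_, fun O hO => ?_, fun i j hij => ?_⟩
  · have hset : {O : Set X | GibbonsHawking.IsGeodesicOrbit G.g O}
        = (fun q => G.μ ⁻¹' {q}) ''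
          {q | q ∉ Set.range p ∧ fderiv ℝ (GibbonsHawking.potential m p) q = 0} := Set.ext hiff
    have hinj : Function.Injective fun q => G.μ ⁻¹' {q} := fun a b hab => by
      have := congrArg (G.μ '' ·) hab
      simpa only [himage, Set.singleton_eq_singleton_iff] using this
    rw [hset, hinj.encard_image, hcard]
  · obtain ⟨q, hq, rfl⟩ := (hiff O).1 hO
    obtain ⟨i, j, hij, hseg⟩ := hbetween q hq
    exact ⟨i, j, hij, q, hseg, himage q⟩
  · obtain ⟨q, ⟨hq, hseg⟩, hu⟩ := huniq i j hij
    refine ⟨G.μ ⁻¹' {q}, ⟨(hiff _).2 ⟨q, hq, rfl⟩, q, hseg, himage q⟩, ?_⟩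
    rintro O ⟨hO, r, hr, hOr⟩
    obtain ⟨q', hq', rfl⟩ := (hiff O).1 hO
    rw [himage, Set.singleton_eq_singleton_iff] at hOr
    subst hOr
    rw [hu q' ⟨hq', hr⟩]
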